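/- \textbf{Definitions.} A \emph{complete Boolean homomorphism} is a map between complete Boolean algebras preserving complements and all joins and meets; for such $\varphi:A\to B$ let $\varphi_\Lambda:B\to A$ be its lower adjoint, i.e. $\varphi_\Lambda(b)\le a$ iff $b\le\varphi(a)$. Boolean algebras with $0=1$ are allowed; complements are denoted by ${}^*$. A \emph{complete local contact algebra} (CLCA) $(B,\rho,\mathbb B)$ is a complete Boolean algebra $B$ with a binary relation $\rho$ and a subset $\mathbb B\subseteq B$ such that, writing $a\ll_\rho b$ for ``not $a\,\rho\,b^*$'': (C1) $a\ne0\Rightarrow a\rho a$; (C2) $a\rho b\Rightarrow a\neq0$ and $b\ne0$; (C3) $a\rho b\Rightarrow b\rho a$; (C4) $a\rho(b\vee c)$ iff $a\rho b$ or $a\rho c$; (BB1) $0\in\mathbb B$; (BB2) $a\le b\in\mathbb B\Rightarrow a\in\mathbb B$; (BB3) $a,b\in\mathbb B\Rightarrow a\vee b\in\mathbb B$; (BC1) if $a\in\mathbb B$ and $a\ll_\rho c$, then $a\ll_\rho b\ll_\rho c$ for some $b\in\mathbb B$; (BC2) if $a\rho b$, then $a\rho(c\wedge b)$ for some $c\in\mathbb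 B$; (BC3) if $a\ne0$, then $b\ll_\rho a$ for some $b\in\mathbb B\setminus\{0\}$. A \emph{complete MVD-algebra} $(B,\le,\ll)$ is a complete Boolean algebra with a binary relation $\ll$ such that: ($\ll$1) $a\ll b\Rightarrow a\le b$; ($\ll$2) $0\ll0$; ($\ll$3) $a\le b\ll c\le t\Rightarrow a\ll t$; ($\ll$4) $a\ll c$ and $b\ll c$ imply $a\vee b\ll c$; ($\ll$5) $a\ll c$ implies $a\ll b\ll c$ for some $b$; ($\ll$6) if $a\ne0$, then $b\ll a$ for some $b\neq0$; ($\ll4^*$) $a\ll b$ and $a\ll c$ imply $a\ll b\wedge c$; (MVD) $a\ll1$ and $b^*\ll a^*$ imply $a\ll b$. Consider the following conditions on a complete Boolean homomorphism $\varphi$ between CLCAs $(A,\rho,\mathbb B)\to(B,\eta,\mathbb B')$: (L1) $\varphi(a)\,\eta\,\varphi(b)\Rightarrow a\rho b$; (L2) $b\in\mathbb B'\Rightarrow\varphi_\Lambda(b)\in\mathbb B$; (L3) $a\in\mathbb B\Rightarrow\varphi(a)\in\mathbb B'$; (LO) for $a\in A$, $b\in\mathbb B'$: $\varphi_\Lambda(b)\,\rho\,a\Rightarrow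 b\,\eta\,\varphi(a)$; and, between complete MVD-algebras $(A,\le,\ll)\to(B,\le',\ll')$: (ES1) $a\ll b\Rightarrow\varphi(a)\ll'\varphi(b)$; (S2) $b\ll'1\Rightarrow\varphi_\Lambda(b)\ll1$; (S3) $a\ll1\Rightarrow\varphi(a)\ll'1$; (SO) $b\ll'\varphi(a)\Rightarrow\varphi_\Lambda(b)\ll a$. Let $\mathbf{IOPAL}$ (resp. $\mathbf{SOPAL}$) be the category of all CLCAs and all injective (resp. surjective) complete Boolean homomorphisms satisfying (L1)--(L3) and (LO); let $\mathbf{IIPA}$ (resp. $\mathbf{SIPA}$) be the category of all complete MVD-algebras and all injective (resp. surjective) complete Boolean homomorphisms satisfying (ES1), (S2), (S3) and (SO). Let $\mathbf{SOPLC}$ (resp. $\mathbf{IOPLC}$) be the category of all locally compact Hausdorff spaces and all surjective (resp. injective) open perfect maps, i.e. continuous maps that are open, closed, and have compact point inverses. Composition is the usual composition of maps in each case. \textbf{Theorem.} (i) The categories $\mathbf{IOPAL}$ and $\mathbf{IIPA}$ are isomorphic (there are mutually inverse functors between them); hence the categories $\mathbf{SOPLC}$ and $\mathbf{IIPA}$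 are dually equivalent, i.e. $\mathbf{SOPLC}^{\mathrm{op}}$ is equivalent to $\mathbf{IIPA}$. (ii) The categories $\mathbf{SOPAL}$ and $\mathbf{SIPA}$ are isomorphic; hence the categories $\mathbf{IOPLC}$ and $\mathbf{SIPA}$ are dually equivalent. -/

import Mathlib

universe u

open CategoryTheory

namespace MVDDuality

/-! ## Lower adjoints of complete Boolean homomorphisms

A complete Boolean homomorphism between complete Boolean algebras is a map preserving all joins
and all meets (complements are then preserved), i.e. a `CompleteLatticeHom`. -/

section LowerAdjoint

variable {A B D : Type u} [CompleteBooleanAlgebra A] [CompleteBooleanAlgebra B]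
  [CompleteBooleanAlgebra D]

/-- The lower adjoint of a complete Boolean homomorphism. -/
def lowerAdjoint (φ : CompleteLatticeHom A B) (b : B) : A := sInf {a | b ≤ φ a}

/-- The defining property of the lower adjoint. -/
theorem lowerAdjoint_gc (φ : CompleteLatticeHom A B) :
    GaloisConnection (lowerAdjoint φ) φ := by
  intro b a
  constructor
  · intro h
    have h1 : b ≤ φ (lowerAdjoint φ b) := by
      unfold lowerAdjoint
      rw [map_sInf]
      apply le_sInf
      rintro _ ⟨x, hx, rfl⟩
      exact hx
    exact h1.trans (OrderHomClass.mono φ h)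
  · intro h
    exact sInf_le h

theorem lowerAdjoint_id (b : B) : lowerAdjoint (CompleteLatticeHom.id B) b = b :=
  (lowerAdjoint_gc (CompleteLatticeHom.id B)).l_unique GaloisConnection.id
    (fun _ => rfl)

theorem lowerAdjoint_comp (ψ : CompleteLatticeHom B D) (φ : CompleteLatticeHom A B) (d : D) :
    lowerAdjoint (ψ.comp φ) d = lowerAdjoint φ (lowerAdjoint ψ d) :=
  (lowerAdjoint_gc (ψ.comp φ)).l_unique
    ((lowerAdjoint_gc ψ).compose (lowerAdjoint_gc φ)) (fun _ => rfl)

end LowerAdjoint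

/-! ## Local contact algebras -/

/-- `C` is a contact relation on the Boolean algebra `B`. -/
structure IsContact {B : Type u} [BooleanAlgebra B] (C : B → B → Prop) : Prop where
  c1 : ∀ a, a ≠ ⊥ → C a a
  c2 : ∀ a b, C a b → a ≠ ⊥ ∧ b ≠ ⊥
  c3 : ∀ a b, C a b → C b a
  c4 : ∀ a b c, C a (b ⊔ c) ↔ C a b ∨ C a c

/-- Non-tangential inclusion `a ≪_C b`. -/
def NonTangential {B : Type u} [BooleanAlgebra B] (C : B → B → Prop) (a b : B) : Prop :=
  ¬ C a bᶜ

/-- `(B, ρ, bdd)` is a local contact algebra, `bdd` being its set of bounded elements. -/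
structure IsLocalContact {B : Type u} [BooleanAlgebra B] (ρ : B → B → Prop) (bdd : Set B) : Prop
    extends IsContact ρ where
  bb1 : ⊥ ∈ bdd
  bb2 : ∀ a b, a ≤ b → b ∈ bdd → a ∈ bdd
  bb3 : ∀ a b, a ∈ bdd → b ∈ bdd → a ⊔ b ∈ bdd
  bc1 : ∀ a c, a ∈ bdd → NonTangential ρ a c →
    ∃ b ∈ bdd, NonTangential ρ a b ∧ NonTangential ρ b c
  bc2 : ∀ a b, ρ a b → ∃ c ∈ bdd, ρ a (c ⊓ b)
  bc3 : ∀ a, a ≠ ⊥ → ∃ b ∈ bdd, b ≠ ⊥ ∧ NonTangential ρ b a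

/-- Complete local contact algebras. -/
structure CLCA : Type (u + 1) where
  carrier : Type u
  [str : CompleteBooleanAlgebra carrier]
  contact : carrier → carrier → Prop
  bounded : Set carrier
  isLocalContact : IsLocalContact contact bounded

attribute [instance] CLCA.str

/-- Conditions (L1), (L2), (L3) and (LO) for a complete Boolean homomorphism between complete
local contact algebras. -/
structure IsOpenPerfectLC {A B : CLCA.{u}} (φ : CompleteLatticeHom A.carrier B.carrier) :
    Prop where
  l1 : ∀ a b, B.contact (φ a) (φ b) → A.contact a b
  l2 : ∀ b ∈ B.bounded, lowerAdjoint φ b ∈ A.bounded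
  l3 : ∀ a ∈ A.bounded, φ a ∈ B.bounded
  lo : ∀ a, ∀ b ∈ B.bounded, A.contact (lowerAdjoint φ b) a → B.contact b (φ a)

theorem IsOpenPerfectLC.id (A : CLCA.{u}) :
    IsOpenPerfectLC (A := A) (B := A) (CompleteLatticeHom.id A.carrier) where
  l1 := fun _ _ h => h
  l2 := fun b hb => by rwa [lowerAdjoint_id]
  l3 := fun _ h => h
  lo := fun a b _ h => by rwa [lowerAdjoint_id] at h

theorem IsOpenPerfectLC.comp {A B D : CLCA.{u}} {ψ : CompleteLatticeHom B.carrier D.carrier}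
    {φ : CompleteLatticeHom A.carrier B.carrier} (hψ : IsOpenPerfectLC ψ)
    (hφ : IsOpenPerfectLC φ) : IsOpenPerfectLC (A := A) (B := D) (ψ.comp φ) where
  l1 := fun a b h => hφ.l1 a b (hψ.l1 _ _ h)
  l2 := fun d hd => by rw [lowerAdjoint_comp]; exact hφ.l2 _ (hψ.l2 _ hd)
  l3 := fun a ha => hψ.l3 _ (hφ.l3 a ha)
  lo := fun a d hd h => by
    rw [lowerAdjoint_comp] at h
    exact hψ.lo _ _ hd (hφ.lo _ _ (hψ.l2 _ hd) h)

/-! ## MVD-algebras -/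

/-- `(B, ≤, ll)` is an MVD-algebra. -/
structure IsMVD {B : Type u} [BooleanAlgebra B] (ll : B → B → Prop) : Prop where
  ll1 : ∀ a b, ll a b → a ≤ b
  ll2 : ll ⊥ ⊥
  ll3 : ∀ a b c t, a ≤ b → ll b c → c ≤ t → ll a t
  ll4 : ∀ a b c, ll a c → ll b c → ll (a ⊔ b) c
  ll5 : ∀ a c, ll a c → ∃ b, ll a b ∧ ll b c
  ll6 : ∀ a, a ≠ ⊥ → ∃ b, b ≠ ⊥ ∧ ll b a
  ll4' : ∀ a b c, ll a b → ll a c → ll a (b ⊓ c)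
  mvd : ∀ a b, ll a ⊤ → ll bᶜ aᶜ → ll a b

/-- Complete MVD-algebras. -/
structure CMVD : Type (u + 1) where
  carrier : Type u
  [str : CompleteBooleanAlgebra carrier]
  ll : carrier → carrier → Prop
  isMVD : IsMVD ll

attribute [instance] CMVD.str

/-- Conditions (ES1), (S2), (S3) and (SO) for a complete Boolean homomorphism between complete
MVD-algebras. -/
structure IsOpenPerfectMVD {A B : CMVD.{u}} (φ : CompleteLatticeHom A.carrier B.carrier) :
    Prop where
  es1 : ∀ a b, A.ll a b → B.ll (φ a) (φ b)
  s2 : ∀ b, B.ll b ⊤ → A.ll (lowerAdjoint φ b) ⊤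
  s3 : ∀ a, A.ll a ⊤ → B.ll (φ a) ⊤
  so : ∀ a b, B.ll b (φ a) → A.ll (lowerAdjoint φ b) a

theorem IsOpenPerfectMVD.id (A : CMVD.{u}) :
    IsOpenPerfectMVD (A := A) (B := A) (CompleteLatticeHom.id A.carrier) where
  es1 := fun _ _ h => h
  s2 := fun b hb => by rwa [lowerAdjoint_id]
  s3 := fun _ h => h
  so := fun a b h => by rwa [lowerAdjoint_id]

theorem IsOpenPerfectMVD.comp {A B D : CMVD.{u}} {ψ : CompleteLatticeHom B.carrier D.carrier}
    {φ : CompleteLatticeHom A.carrier B.carrier} (hψ : IsOpenPerfectMVD ψ)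
    (hφ : IsOpenPerfectMVD φ) : IsOpenPerfectMVD (A := A) (B := D) (ψ.comp φ) where
  es1 := fun a b h => hψ.es1 _ _ (hφ.es1 a b h)
  s2 := fun d hd => by rw [lowerAdjoint_comp]; exact hφ.s2 _ (hψ.s2 _ hd)
  s3 := fun a ha => hψ.s3 _ (hφ.s3 a ha)
  so := fun a d h => by rw [lowerAdjoint_comp]; exact hφ.so _ _ (hψ.so _ _ h)

/-! ## The algebraic categories

Each category has its own (one-field) type of objects, so that it carries its own morphisms. -/

/-- Complete local contact algebras with injective complete Boolean homomorphisms satisfying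
(L1), (L2), (L3), (LO). -/
structure IOPAL : Type (u + 1) where
  toCLCA : CLCA.{u}

instance : Category.{u} IOPAL.{u} where
  Hom A B := {φ : CompleteLatticeHom A.toCLCA.carrier B.toCLCA.carrier //
    IsOpenPerfectLC φ ∧ Function.Injective φ}
  id A := ⟨CompleteLatticeHom.id _, IsOpenPerfectLC.id _, Function.injective_id⟩
  comp f g := ⟨g.1.comp f.1, g.2.1.comp f.2.1, g.2.2.comp f.2.2⟩

/-- Complete local contact algebras with surjective complete Boolean homomorphisms satisfying
(L1), (L2), (L3), (LO). -/
structure SOPAL : Type (u + 1) where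
  toCLCA : CLCA.{u}

instance : Category.{u} SOPAL.{u} where
  Hom A B := {φ : CompleteLatticeHom A.toCLCA.carrier B.toCLCA.carrier //
    IsOpenPerfectLC φ ∧ Function.Surjective φ}
  id A := ⟨CompleteLatticeHom.id _, IsOpenPerfectLC.id _, Function.surjective_id⟩
  comp f g := ⟨g.1.comp f.1, g.2.1.comp f.2.1, g.2.2.comp f.2.2⟩

/-- Complete MVD-algebras with injective complete Boolean homomorphisms satisfying
(ES1), (S2), (S3), (SO). -/
structure IIPA : Type (u + 1) where
  toCMVD : CMVD.{u}

instance : Category.{u} IIPA.{u} where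
  Hom A B := {φ : CompleteLatticeHom A.toCMVD.carrier B.toCMVD.carrier //
    IsOpenPerfectMVD φ ∧ Function.Injective φ}
  id A := ⟨CompleteLatticeHom.id _, IsOpenPerfectMVD.id _, Function.injective_id⟩
  comp f g := ⟨g.1.comp f.1, g.2.1.comp f.2.1, g.2.2.comp f.2.2⟩

/-- Complete MVD-algebras with surjective complete Boolean homomorphisms satisfying
(ES1), (S2), (S3), (SO). -/
structure SIPA : Type (u + 1) where
  toCMVD : CMVD.{u}

instance : Category.{u} SIPA.{u} where
  Hom A B := {φ : CompleteLatticeHom A.toCMVD.carrier B.toCMVD.carrier //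
    IsOpenPerfectMVD φ ∧ Function.Surjective φ}
  id A := ⟨CompleteLatticeHom.id _, IsOpenPerfectMVD.id _, Function.surjective_id⟩
  comp f g := ⟨g.1.comp f.1, g.2.1.comp f.2.1, g.2.2.comp f.2.2⟩

/-! ## The topological categories -/

/-- Locally compact Hausdorff spaces. -/
structure LCHaus : Type (u + 1) where
  carrier : Type u
  [top : TopologicalSpace carrier]
  [locallyCompact : LocallyCompactSpace carrier]
  [t2 : T2Space carrier]

attribute [instance] LCHaus.top LCHaus.locallyCompact LCHaus.t2

/-- Open perfect maps: continuous, open, closed, and with compact point inverses. -/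
structure IsOpenPerfect {X Y : Type u} [TopologicalSpace X] [TopologicalSpace Y] (f : X → Y) :
    Prop where
  continuous : Continuous f
  isOpenMap : IsOpenMap f
  isClosedMap : IsClosedMap f
  isCompact_fiber : ∀ y, IsCompact (f ⁻¹' {y})

theorem IsOpenPerfect.id (X : Type u) [TopologicalSpace X] :
    IsOpenPerfect (fun x : X => x) where
  continuous := continuous_id
  isOpenMap := IsOpenMap.id
  isClosedMap := IsClosedMap.id
  isCompact_fiber := fun _ => isCompact_singleton

theorem IsOpenPerfect.comp {X Y Z : Type u} [TopologicalSpace X] [TopologicalSpace Y]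
    [TopologicalSpace Z] {g : Y → Z} {f : X → Y} (hg : IsOpenPerfect g)
    (hf : IsOpenPerfect f) : IsOpenPerfect (fun x => g (f x)) where
  continuous := hg.continuous.comp hf.continuous
  isOpenMap := hg.isOpenMap.comp hf.isOpenMap
  isClosedMap := hg.isClosedMap.comp hf.isClosedMap
  isCompact_fiber := fun z =>
    (isProperMap_iff_isClosedMap_and_compact_fibers.2
      ⟨hf.continuous, hf.isClosedMap, hf.isCompact_fiber⟩).isCompact_preimage
      (hg.isCompact_fiber z)

/-- Locally compact Hausdorff spaces with surjective open perfect maps. -/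
structure SOPLC : Type (u + 1) where
  toLCHaus : LCHaus.{u}

instance : Category.{u} SOPLC.{u} where
  Hom X Y := {f : X.toLCHaus.carrier → Y.toLCHaus.carrier //
    IsOpenPerfect f ∧ Function.Surjective f}
  id X := ⟨fun x => x, IsOpenPerfect.id _, Function.surjective_id⟩
  comp f g := ⟨fun x => g.1 (f.1 x), g.2.1.comp f.2.1, g.2.2.comp f.2.2⟩

/-- Locally compact Hausdorff spaces with injective open perfect maps. -/
structure IOPLC : Type (u + 1) where
  toLCHaus : LCHaus.{u}

instance : Category.{u} IOPLC.{u} where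
  Hom X Y := {f : X.toLCHaus.carrier → Y.toLCHaus.carrier //
    IsOpenPerfect f ∧ Function.Injective f}
  id X := ⟨fun x => x, IsOpenPerfect.id _, Function.injective_id⟩
  comp f g := ⟨fun x => g.1 (f.1 x), g.2.1.comp f.2.1, g.2.2.comp f.2.2⟩

/-! ## Isomorphic and dually equivalent categories -/

/-- Isomorphism of categories in the strict sense: mutually inverse functors. -/
def AreIsomorphic (C D : Type (u + 1)) [Category.{u} C] [Category.{u} D] : Prop :=
  ∃ (K : C ⥤ D) (T : D ⥤ C), K ⋙ T = 𝟭 C ∧ T ⋙ K = 𝟭 D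

/-- Dual equivalence of categories. -/
def AreDuallyEquivalent (C D : Type (u + 1)) [Category.{u} C] [Category.{u} D] : Prop :=
  Nonempty (Cᵒᵖ ≌ D)

end MVDDuality

/-! On a fixed Boolean algebra the two structures carry the same information. A local contact
algebra gives `a ≪ b` when `a` is bounded and not in contact with `bᶜ`. Conversely, `a` is bounded
when `a ≪ ⊤`, and `a` touches `b` when some bounded `c ≤ a` fails `c ≪ bᶜ`. The passages are
mutually inverse: (BC2) says that contact is detected on bounded parts, and (MVD) makes the second
relation symmetric. The conditions on homomorphisms correspond too, so the functors that keep the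
underlying maps are strictly inverse.

The dualities are proved directly on the MVD side. A space goes to its regular open sets, with `U ≪
V` when `closure U` is compact and contained in `V`; a map goes to its preimage operation. Fullness:
(S2), compactness and (ES1) yield, for each `x`, a point `y` such that `x ∈ φ U` whenever `y ∈ U`;
(SO) makes this map `f` satisfy `φ U = f ⁻¹' U` (`IsOpenPerfectMVD.exists_map`). Essential
surjectivity: a complete MVD-algebra is the algebra of regular open sets of its space of round,
`≪`-prime filters (`CMVD.Point.orderIso`). Injective homomorphisms match surjective maps and vice
versa, so one construction serves both statements. -/

namespace MVDDuality

/-! ## Local contact algebras and MVD-algebras are the same thing -/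

section Relations

variable {B : Type u} [BooleanAlgebra B]

namespace IsMVD

variable {ll : B → B → Prop} (h : IsMVD ll)
include h

theorem mono_left {a b c : B} (hab : a ≤ b) (hbc : ll b c) : ll a c := h.ll3 a b c c hab hbc le_rfl

theorem mono_right {a b c : B} (hab : ll a b) (hbc : b ≤ c) : ll a c := h.ll3 a a b c le_rfl hab hbc

theorem ll_top {a b : B} (hab : ll a b) : ll a ⊤ := h.mono_right hab le_top

theorem bot_ll (a : B) : ll ⊥ a := h.mono_right h.ll2 bot_le

theorem inf_ll_inf {a b c d : B} (hac : ll a c) (hbd : ll b d) : ll (a ⊓ b) (c ⊓ d) :=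
  h.ll4' _ _ _ (h.mono_left inf_le_left hac) (h.mono_left inf_le_right hbd)

/-- (MVD) needs a bounded left side and `bᶜ` need not be bounded; cutting down by a bounded `e`
repairs this. -/
theorem inf_compl_ll_compl {a b e : B} (hab : ll a b) (he : ll e ⊤) : ll (e ⊓ bᶜ) aᶜ := by
  refine h.mvd _ _ (h.mono_left inf_le_left he) ?_
  rw [compl_compl]
  exact h.mono_right hab (by rw [compl_inf, compl_compl]; exact le_sup_right)

end IsMVD

theorem NonTangential.mono {ρ : B → B → Prop} (h : IsContact ρ) {a b c d : B} (hab : a ≤ b)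
    (hcd : c ≤ d) (hbc : NonTangential ρ b c) : NonTangential ρ a d := by
  intro had
  have h1 : ρ a cᶜ := by
    rw [← sup_eq_right.2 (compl_le_compl hcd), h.c4]
    exact Or.inl had
  have h2 : ρ cᶜ b := by
    rw [← sup_eq_right.2 hab, h.c4]
    exact Or.inl (h.c3 _ _ h1)
  exact hbc (h.c3 _ _ h2)

theorem NonTangential.compl {ρ : B → B → Prop} (h : IsContact ρ) {a b : B}
    (hab : NonTangential ρ a b) : NonTangential ρ bᶜ aᶜ := by
  intro hba
  rw [compl_compl] at hba
  exact hab (h.c3 _ _ hba)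

/-- The MVD-relation of a local contact algebra. -/
def llOfContact (ρ : B → B → Prop) (bdd : Set B) (a b : B) : Prop := a ∈ bdd ∧ NonTangential ρ a b

/-- The contact relation of an MVD-algebra. -/
def contactOfLL (ll : B → B → Prop) (a b : B) : Prop := ∃ c, c ≤ a ∧ ll c ⊤ ∧ ¬ ll c bᶜ

/-- The bounded elements of an MVD-algebra. -/
def boundedOfLL (ll : B → B → Prop) : Set B := {a | ll a ⊤}

theorem IsLocalContact.isMVD {ρ : B → B → Prop} {bdd : Set B} (h : IsLocalContact ρ bdd) :
    IsMVD (llOfContact ρ bdd) where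
  ll1 := by
    rintro a b ⟨-, hab⟩
    by_contra hle
    have h0 : a ⊓ bᶜ ≠ ⊥ := fun h0 => hle (le_compl_iff_disjoint_right.2
      (disjoint_iff.2 h0) |>.trans_eq (compl_compl b))
    have h1 := NonTangential.mono h.toIsContact (inf_le_left : a ⊓ bᶜ ≤ a)
      (c := b) (d := (a ⊓ bᶜ)ᶜ) (by rw [compl_inf, compl_compl]; exact le_sup_right) hab
    unfold NonTangential at h1
    rw [compl_compl] at h1
    exact h1 (h.c1 _ h0)
  ll2 := ⟨h.bb1, fun hc => (h.c2 _ _ hc).1 rfl⟩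
  ll3 := fun a b c t hab hbc hct =>
    ⟨h.bb2 _ _ hab hbc.1, NonTangential.mono h.toIsContact hab hct hbc.2⟩
  ll4 := fun a b c hac hbc => ⟨h.bb3 _ _ hac.1 hbc.1, fun hc =>
    ((h.c4 _ _ _).1 (h.c3 _ _ hc)).elim (fun h' => hac.2 (h.c3 _ _ h'))
      (fun h' => hbc.2 (h.c3 _ _ h'))⟩
  ll5 := fun a c hac => by
    obtain ⟨b, hb, hab, hbc⟩ := h.bc1 a c hac.1 hac.2
    exact ⟨b, ⟨hac.1, hab⟩, hb, hbc⟩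
  ll6 := fun a ha => by
    obtain ⟨b, hb, hb0, hba⟩ := h.bc3 a ha
    exact ⟨b, hb0, hb, hba⟩
  ll4' := fun a b c hab hac => ⟨hab.1, fun hc => by
    rw [compl_inf, h.c4] at hc
    exact hc.elim hab.2 hac.2⟩
  mvd := fun a b ha hba => ⟨ha.1, by
    have := NonTangential.compl h.toIsContact hba.2
    rwa [compl_compl, compl_compl] at this⟩

theorem not_contactOfLL_iff {ll : B → B → Prop} {a b : B} :
    ¬ contactOfLL ll a b ↔ ∀ c, c ≤ a → ll c ⊤ → ll c bᶜ := by
  simp [contactOfLL]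

theorem nonTangential_contactOfLL_iff {ll : B → B → Prop} {a b : B} :
    NonTangential (contactOfLL ll) a b ↔ ∀ c, c ≤ a → ll c ⊤ → ll c b := by
  rw [NonTangential, not_contactOfLL_iff, compl_compl]

/-- The definition treats its two arguments differently, and symmetry rests on (MVD). If `b` does
not touch `a`, then for `c ≪ e ≪ ⊤` the bounded element `e ⊓ b` is `≪ cᶜ`, so `c ≪ (e ⊓ b)ᶜ`;
meeting with `c ≪ e` gives `c ≪ bᶜ`. -/
theorem IsMVD.contactOfLL_symm {ll : B → B → Prop} (h : IsMVD ll) {a b : B}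
    (hab : contactOfLL ll a b) : contactOfLL ll b a := by
  by_contra hba
  rw [not_contactOfLL_iff] at hba
  obtain ⟨c, hca, hc, hcb⟩ := hab
  obtain ⟨e, hce, he⟩ := h.ll5 _ _ hc
  have h1 : ll (e ⊓ b) cᶜ :=
    h.mono_right (hba (e ⊓ b) inf_le_right (h.mono_left inf_le_left he)) (compl_le_compl hca)
  have h2 : ll c (e ⊓ b)ᶜ := h.mvd _ _ hc (by rwa [compl_compl])
  refine hcb (h.mono_right (h.ll4' _ _ _ hce h2) ?_)
  rw [compl_inf, inf_sup_left, inf_compl_self, bot_sup_eq]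
  exact inf_le_right

theorem IsMVD.isLocalContact {ll : B → B → Prop} (h : IsMVD ll) :
    IsLocalContact (contactOfLL ll) (boundedOfLL ll) where
  c1 := fun a ha => by
    obtain ⟨b, hb, hba⟩ := h.ll6 a ha
    exact ⟨b, h.ll1 _ _ hba, h.ll_top hba, fun hc => hb
      (le_bot_iff.1 (inf_compl_self a ▸ le_inf (h.ll1 _ _ hba) (h.ll1 _ _ hc)))⟩
  c2 := by
    rintro a b ⟨c, hca, hc, hcb⟩
    refine ⟨?_, ?_⟩
    · rintro rfl
      exact hcb (h.mono_left hca (h.bot_ll _))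
    · rintro rfl
      exact hcb (by rwa [compl_bot])
  c3 := fun a b => h.contactOfLL_symm
  c4 := fun a b c => by
    constructor
    · rintro ⟨d, hda, hd, hdc⟩
      by_cases hdb : ll d bᶜ
      · exact Or.inr ⟨d, hda, hd, fun hd' => hdc (by rw [compl_sup]; exact h.ll4' _ _ _ hdb hd')⟩
      · exact Or.inl ⟨d, hda, hd, hdb⟩
    · rintro (⟨d, hda, hd, hdc⟩ | ⟨d, hda, hd, hdc⟩)
      · exact ⟨d, hda, hd, fun hd' => hdc (h.mono_right hd' (compl_le_compl le_sup_left))⟩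
      · exact ⟨d, hda, hd, fun hd' => hdc (h.mono_right hd' (compl_le_compl le_sup_right))⟩
  bb1 := h.bot_ll _
  bb2 := fun _ _ hab hb => h.mono_left hab hb
  bb3 := fun _ _ ha hb => h.ll4 _ _ _ ha hb
  bc1 := fun a c ha hac => by
    obtain ⟨b, hab, hbc⟩ := h.ll5 _ _ (nonTangential_contactOfLL_iff.1 hac a le_rfl ha)
    exact ⟨b, h.ll_top hbc, nonTangential_contactOfLL_iff.2 fun c hca _ => h.mono_left hca hab,
      nonTangential_contactOfLL_iff.2 fun c hca _ => h.mono_left hca hbc⟩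
  bc2 := fun a b hab => by
    -- The bounded witness always sits inside the first argument, so the arguments are exchanged to
    -- find one below `b`.
    obtain ⟨c, hcb, hc, hca⟩ := h.contactOfLL_symm hab
    exact ⟨c, hc, h.contactOfLL_symm ⟨c, le_inf le_rfl hcb, hc, hca⟩⟩
  bc3 := fun a ha => by
    obtain ⟨b, hb, hba⟩ := h.ll6 a ha
    exact ⟨b, h.ll_top hba, hb,
      nonTangential_contactOfLL_iff.2 fun c hcb _ => h.mono_left hcb hba⟩

theorem IsMVD.llOfContact_contactOfLL {ll : B → B → Prop} (h : IsMVD ll) :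
    llOfContact (contactOfLL ll) (boundedOfLL ll) = ll := by
  ext a b
  simp only [llOfContact, nonTangential_contactOfLL_iff]
  exact ⟨fun hab => hab.2 a le_rfl hab.1, fun hab => ⟨h.ll_top hab, fun c hc _ =>
    h.mono_left hc hab⟩⟩

theorem IsLocalContact.llOfContact_top {ρ : B → B → Prop} {bdd : Set B}
    (h : IsLocalContact ρ bdd) {a : B} : llOfContact ρ bdd a ⊤ ↔ a ∈ bdd :=
  ⟨fun ha => ha.1, fun ha => ⟨ha, fun hc => (h.c2 _ _ hc).2 compl_top⟩⟩

theorem IsLocalContact.boundedOfLL_llOfContact {ρ : B → B → Prop} {bdd : Set B}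
    (h : IsLocalContact ρ bdd) : boundedOfLL (llOfContact ρ bdd) = bdd := by
  ext a
  exact h.llOfContact_top

theorem IsLocalContact.mono {ρ : B → B → Prop} {bdd : Set B}
    (h : IsLocalContact ρ bdd) {a b c : B} (hab : ρ a b) (hac : a ≤ c) : ρ c b := by
  by_contra hcb
  rw [← compl_compl b] at hab hcb
  exact NonTangential.mono h.toIsContact hac le_rfl hcb hab

/-- (BC2) is the axiom that recovers all of `ρ` from its restriction to bounded elements. -/
theorem IsLocalContact.contactOfLL_llOfContact {ρ : B → B → Prop} {bdd : Set B}
    (h : IsLocalContact ρ bdd) : contactOfLL (llOfContact ρ bdd) = ρ := by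
  ext a b
  constructor
  · rintro ⟨c, hca, hc, hcb⟩
    by_contra hab
    refine hcb ⟨hc.1, fun hcb' => hab ?_⟩
    rw [compl_compl] at hcb'
    exact h.mono hcb' hca
  · intro hab
    obtain ⟨c, hc, hbc⟩ := h.bc2 _ _ (h.c3 _ _ hab)
    refine ⟨c ⊓ a, inf_le_right, h.llOfContact_top.2 (h.bb2 _ _ inf_le_left hc), fun h' => h'.2 ?_⟩
    rw [compl_compl]
    exact h.c3 _ _ hbc

end Relations

/-! ### The strict isomorphisms of categories. -/

/-- The complete MVD-algebra of a complete local contact algebra. -/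
@[reducible] def CLCA.toCMVD (A : CLCA.{u}) : CMVD.{u} :=
  ⟨A.carrier, llOfContact A.contact A.bounded, A.isLocalContact.isMVD⟩

/-- The complete local contact algebra of a complete MVD-algebra. -/
@[reducible] def CMVD.toCLCA (A : CMVD.{u}) : CLCA.{u} :=
  ⟨A.carrier, contactOfLL A.ll, boundedOfLL A.ll, A.isMVD.isLocalContact⟩

theorem CLCA.toCLCA_toCMVD (A : CLCA.{u}) : A.toCMVD.toCLCA = A := by
  obtain ⟨X, ρ, bdd, h⟩ := A
  simp only [CLCA.toCMVD, CMVD.toCLCA, h.contactOfLL_llOfContact, h.boundedOfLL_llOfContact]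

theorem CMVD.toCMVD_toCLCA (A : CMVD.{u}) : A.toCLCA.toCMVD = A := by
  obtain ⟨X, ll, h⟩ := A
  simp only [CLCA.toCMVD, CMVD.toCLCA, h.llOfContact_contactOfLL]

/-- A complete Boolean homomorphism satisfies (L1)--(L3), (LO) if and only if it satisfies
(ES1), (S2), (S3), (SO) for the associated MVD-relations. -/
theorem IsOpenPerfectLC.toMVD {A B : CLCA.{u}} {φ : CompleteLatticeHom A.carrier B.carrier}
    (h : IsOpenPerfectLC φ) : IsOpenPerfectMVD (A := A.toCMVD) (B := B.toCMVD) φ where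
  es1 := fun a b hab => ⟨h.l3 _ hab.1, fun hc => hab.2 (h.l1 _ _ (by rwa [map_compl']))⟩
  s2 := fun b hb => A.isLocalContact.llOfContact_top.2 (h.l2 _ hb.1)
  s3 := fun a ha => B.isLocalContact.llOfContact_top.2 (h.l3 _ ha.1)
  so := fun a b hb => ⟨h.l2 _ hb.1, fun hc => hb.2 (by
    have := h.lo _ _ hb.1 hc
    rwa [map_compl'] at this)⟩

theorem IsOpenPerfectMVD.toLC {A B : CMVD.{u}} {φ : CompleteLatticeHom A.carrier B.carrier}
    (h : IsOpenPerfectMVD φ) : IsOpenPerfectLC (A := A.toCLCA) (B := B.toCLCA) φ where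
  l1 := by
    rintro a b ⟨c, hca, hc, hcb⟩
    -- The adjoint moves the bounded witness `c` from `B` to `A`: were `φ_Λ c ≪ bᶜ`, (ES1) and `c ≤
    -- φ (φ_Λ c)` would give `c ≪ (φ b)ᶜ`.
    refine ⟨lowerAdjoint φ c, (lowerAdjoint_gc φ).l_le hca, h.s2 _ hc, fun h' => hcb ?_⟩
    have := h.es1 _ _ h'
    rw [map_compl'] at this
    exact B.isMVD.mono_left ((lowerAdjoint_gc φ).le_u_l c) this
  l2 := h.s2
  l3 := h.s3
  lo := by
    intro a b hb hba
    by_contra hn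
    rw [not_contactOfLL_iff, ← map_compl'] at hn
    refine not_contactOfLL_iff.2 (fun c hc _ => ?_) hba
    exact A.isMVD.mono_left hc (h.so _ _ (hn b le_rfl hb))

/-- A morphism depends on the relations of its source and target only through its type. -/
theorem CLCA.hom_heq {P : ∀ {A B : CLCA.{u}}, CompleteLatticeHom A.carrier B.carrier → Prop}
    {X Y : Type u} [CompleteBooleanAlgebra X] [CompleteBooleanAlgebra Y]
    {ρ ρ' : X → X → Prop} {b b' : Set X} {h h'} {σ σ' : Y → Y → Prop} {c c' : Set Y} {k k'}
    (f : CompleteLatticeHom X Y)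
    (hf : P (A := ⟨X, ρ, b, h⟩) (B := ⟨Y, σ, c, k⟩) f)
    (hf' : P (A := ⟨X, ρ', b', h'⟩) (B := ⟨Y, σ', c', k'⟩) f)
    (h1 : ρ = ρ') (h2 : b = b') (h3 : σ = σ') (h4 : c = c') :
    HEq (⟨f, hf⟩ : {φ : CompleteLatticeHom X Y // P (A := ⟨X, ρ, b, h⟩) (B := ⟨Y, σ, c, k⟩) φ})
      (⟨f, hf'⟩ : {φ : CompleteLatticeHom X Y //
        P (A := ⟨X, ρ', b', h'⟩) (B := ⟨Y, σ', c', k'⟩) φ}) := by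
  subst h1 h2 h3 h4
  rfl

/-- With the relations as variables their equalities can be substituted, which settles the `HEq`
asked for by `Functor.hext`. Leaving `P` open covers injective and surjective morphisms at once. -/
theorem CMVD.hom_heq {P : ∀ {A B : CMVD.{u}}, CompleteLatticeHom A.carrier B.carrier → Prop}
    {X Y : Type u} [CompleteBooleanAlgebra X] [CompleteBooleanAlgebra Y]
    {ll ll' : X → X → Prop} {h h'} {mm mm' : Y → Y → Prop} {k k'}
    (f : CompleteLatticeHom X Y)
    (hf : P (A := ⟨X, ll, h⟩) (B := ⟨Y, mm, k⟩) f)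
    (hf' : P (A := ⟨X, ll', h'⟩) (B := ⟨Y, mm', k'⟩) f)
    (h1 : ll = ll') (h2 : mm = mm') :
    HEq (⟨f, hf⟩ : {φ : CompleteLatticeHom X Y // P (A := ⟨X, ll, h⟩) (B := ⟨Y, mm, k⟩) φ})
      (⟨f, hf'⟩ : {φ : CompleteLatticeHom X Y //
        P (A := ⟨X, ll', h'⟩) (B := ⟨Y, mm', k'⟩) φ}) := by
  subst h1 h2
  rfl

/-- The functor from `IOPAL` to `IIPA` that is the identity on maps. -/
def IOPAL.toIIPA : IOPAL.{u} ⥤ IIPA.{u} where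
  obj A := ⟨A.toCLCA.toCMVD⟩
  map f := ⟨f.1, f.2.1.toMVD, f.2.2⟩

/-- The functor from `IIPA` to `IOPAL` that is the identity on maps. -/
def IIPA.toIOPAL : IIPA.{u} ⥤ IOPAL.{u} where
  obj A := ⟨A.toCMVD.toCLCA⟩
  map f := ⟨f.1, f.2.1.toLC, f.2.2⟩

/-- The functor from `SOPAL` to `SIPA` that is the identity on maps. -/
def SOPAL.toSIPA : SOPAL.{u} ⥤ SIPA.{u} where
  obj A := ⟨A.toCLCA.toCMVD⟩
  map f := ⟨f.1, f.2.1.toMVD, f.2.2⟩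

/-- The functor from `SIPA` to `SOPAL` that is the identity on maps. -/
def SIPA.toSOPAL : SIPA.{u} ⥤ SOPAL.{u} where
  obj A := ⟨A.toCMVD.toCLCA⟩
  map f := ⟨f.1, f.2.1.toLC, f.2.2⟩

theorem areIsomorphic_IOPAL_IIPA : AreIsomorphic IOPAL.{u} IIPA.{u} := by
  refine ⟨IOPAL.toIIPA, IIPA.toIOPAL, ?_, ?_⟩
  · refine Functor.hext (fun A => congrArg IOPAL.mk A.toCLCA.toCLCA_toCMVD) fun A B f => ?_
    have hA := A.toCLCA.isLocalContact
    have hB := B.toCLCA.isLocalContact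
    exact CLCA.hom_heq (P := fun {A B} φ => IsOpenPerfectLC (A := A) (B := B) φ ∧
      Function.Injective φ) f.1 _ f.2 hA.contactOfLL_llOfContact hA.boundedOfLL_llOfContact
      hB.contactOfLL_llOfContact hB.boundedOfLL_llOfContact
  · refine Functor.hext (fun A => congrArg IIPA.mk A.toCMVD.toCMVD_toCLCA) fun A B f => ?_
    exact CMVD.hom_heq (P := fun {A B} φ => IsOpenPerfectMVD (A := A) (B := B) φ ∧
      Function.Injective φ) f.1 _ f.2 A.toCMVD.isMVD.llOfContact_contactOfLL
      B.toCMVD.isMVD.llOfContact_contactOfLL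

theorem areIsomorphic_SOPAL_SIPA : AreIsomorphic SOPAL.{u} SIPA.{u} := by
  refine ⟨SOPAL.toSIPA, SIPA.toSOPAL, ?_, ?_⟩
  · refine Functor.hext (fun A => congrArg SOPAL.mk A.toCLCA.toCLCA_toCMVD) fun A B f => ?_
    have hA := A.toCLCA.isLocalContact
    have hB := B.toCLCA.isLocalContact
    exact CLCA.hom_heq (P := fun {A B} φ => IsOpenPerfectLC (A := A) (B := B) φ ∧
      Function.Surjective φ) f.1 _ f.2 hA.contactOfLL_llOfContact hA.boundedOfLL_llOfContact
      hB.contactOfLL_llOfContact hB.boundedOfLL_llOfContact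
  · refine Functor.hext (fun A => congrArg SIPA.mk A.toCMVD.toCMVD_toCLCA) fun A B f => ?_
    exact CMVD.hom_heq (P := fun {A B} φ => IsOpenPerfectMVD (A := A) (B := B) φ ∧
      Function.Surjective φ) f.1 _ f.2 A.toCMVD.isMVD.llOfContact_contactOfLL
      B.toCMVD.isMVD.llOfContact_contactOfLL

/-! ## The algebra of regular open sets -/

open TopologicalSpace Topology

/-- Regular open subsets of a topological space. -/
def RegOpens (X : Type u) [TopologicalSpace X] : Type u := Heyting.Regular (Opens X)

instance (X : Type u) [TopologicalSpace X] : CompleteBooleanAlgebra (RegOpens X) :=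
  { (inferInstance : BooleanAlgebra (Heyting.Regular (Opens X))),
    (Heyting.Regular.gi (α := Opens X)).liftCompleteLattice with }

namespace RegOpens

variable {X Y : Type u} [TopologicalSpace X] [TopologicalSpace Y]

/-- The underlying set of a regular open set. -/
def set (U : RegOpens X) : Set X := ((Heyting.Regular.val (α := Opens X) U : Opens X) : Set X)

theorem isOpen (U : RegOpens X) : IsOpen U.set := (Heyting.Regular.val (α := Opens X) U).isOpen

theorem set_le_set {U V : RegOpens X} : U.set ⊆ V.set ↔ U ≤ V := Iff.rfl

theorem set_injective : Function.Injective (set : RegOpens X → Set X) := fun _ _ h =>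
  le_antisymm (set_le_set.1 h.subset) (set_le_set.1 h.superset)

theorem set_bot : (⊥ : RegOpens X).set = ∅ := rfl

theorem set_inf (U V : RegOpens X) : (U ⊓ V).set = U.set ∩ V.set := rfl

theorem set_compl (U : RegOpens X) : Uᶜ.set = (closure U.set)ᶜ := by
  rw [← interior_compl]
  exact Opens.coe_compl_eq_interior_compl

theorem interior_closure_set (U : RegOpens X) : interior (closure U.set) = U.set := by
  conv_rhs => rw [← compl_compl U, set_compl, set_compl]
  rw [closure_compl, compl_compl]

/-- The regular open set that is the interior of the closure of an open set. -/
def ofOpen (s : Set X) (hs : IsOpen s) : RegOpens X := Heyting.Regular.toRegular ⟨s, hs⟩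

theorem set_ofOpen (s : Set X) (hs : IsOpen s) : (ofOpen s hs).set = interior (closure s) := by
  change (((⟨s, hs⟩ : Opens X)ᶜᶜ : Opens X) : Set X) = _
  rw [Opens.coe_compl_eq_interior_compl, Opens.coe_compl_eq_interior_compl, ← closure_compl,
    compl_compl]
  rfl

theorem subset_ofOpen (s : Set X) (hs : IsOpen s) : s ⊆ (ofOpen s hs).set := by
  rw [set_ofOpen]
  exact interior_maximal subset_closure hs

theorem ofOpen_le_iff {s : Set X} {hs : IsOpen s} {U : RegOpens X} :
    ofOpen s hs ≤ U ↔ s ⊆ U.set := by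
  refine ⟨fun h => (subset_ofOpen s hs).trans (set_le_set.2 h), fun h => ?_⟩
  rw [← set_le_set, set_ofOpen, ← interior_closure_set U]
  exact interior_mono (closure_mono h)

theorem closure_ofOpen (s : Set X) (hs : IsOpen s) : closure (ofOpen s hs).set = closure s := by
  refine subset_antisymm ?_ (closure_mono (subset_ofOpen s hs))
  rw [set_ofOpen]
  exact closure_minimal interior_subset isClosed_closure

theorem disjoint_iff_set {U V : RegOpens X} : Disjoint U V ↔ Disjoint U.set V.set := by
  rw [disjoint_iff, Set.disjoint_iff_inter_eq_empty, ← set_inf, ← set_bot]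
  exact set_injective.eq_iff.symm

theorem sSup_eq (S : Set (RegOpens X)) :
    sSup S = ofOpen (⋃ U ∈ S, U.set) (isOpen_biUnion fun U _ => U.isOpen) := by
  apply le_antisymm
  · refine sSup_le fun U hU => ?_
    exact (Set.subset_biUnion_of_mem (u := set) hU).trans (subset_ofOpen _ _)
  · exact ofOpen_le_iff.2 (Set.iUnion₂_subset fun U hU => set_le_set.2 (le_sSup hU))

theorem eq_bot_iff_set {U : RegOpens X} : U = ⊥ ↔ U.set = ∅ := by
  rw [← set_bot, set_injective.eq_iff]

/-- The set of a join can exceed the union, but its closure does not: complements are complements of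
closures, so De Morgan applies. -/
theorem closure_sup (U V : RegOpens X) : closure (U ⊔ V).set = closure U.set ∪ closure V.set := by
  have h : (U ⊔ V)ᶜ.set = Uᶜ.set ∩ Vᶜ.set := by rw [compl_sup, set_inf]
  rw [set_compl, set_compl, set_compl, ← Set.compl_union] at h
  exact compl_injective h

/-- `U` is relatively compact and its closure lies in `V`. -/
def LL (U V : RegOpens X) : Prop := IsCompact (closure U.set) ∧ closure U.set ⊆ V.set

theorem LL.top {U : RegOpens X} : LL U ⊤ ↔ IsCompact (closure U.set) :=
  ⟨fun h => h.1, fun h => ⟨h, Set.subset_univ _⟩⟩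

/-- Between a compact set and an open set there is a relatively compact regular open set. -/
theorem exists_between [LocallyCompactSpace X] [T2Space X] {K s : Set X} (hK : IsCompact K)
    (hs : IsOpen s) (hKs : K ⊆ s) :
    ∃ U : RegOpens X, K ⊆ U.set ∧ IsCompact (closure U.set) ∧ closure U.set ⊆ s := by
  obtain ⟨V, hV, hKV, hVs, hVc⟩ := exists_open_between_and_isCompact_closure hK hs hKs
  exact ⟨ofOpen V hV, hKV.trans (subset_ofOpen _ _), by rwa [closure_ofOpen],
    by rwa [closure_ofOpen]⟩

theorem exists_mem_nhds [LocallyCompactSpace X] [T2Space X] {x : X} {s : Set X}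
    (hs : IsOpen s) (hx : x ∈ s) :
    ∃ U : RegOpens X, x ∈ U.set ∧ IsCompact (closure U.set) ∧ closure U.set ⊆ s := by
  obtain ⟨U, h, h'⟩ := exists_between isCompact_singleton hs (Set.singleton_subset_iff.2 hx)
  exact ⟨U, h rfl, h'⟩

theorem isMVD [LocallyCompactSpace X] [T2Space X] : IsMVD (LL (X := X)) where
  ll1 := fun a b h => subset_closure.trans h.2
  ll2 := by simp [LL, set_bot]
  ll3 := fun a b c t hab hbc hct =>
    ⟨hbc.1.of_isClosed_subset isClosed_closure (closure_mono (set_le_set.2 hab)),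
      (closure_mono (set_le_set.2 hab)).trans (hbc.2.trans (set_le_set.2 hct))⟩
  ll4 := fun a b c hac hbc => by
    rw [LL, closure_sup]
    exact ⟨hac.1.union hbc.1, Set.union_subset hac.2 hbc.2⟩
  ll5 := fun a c hac => by
    obtain ⟨U, h1, h2, h3⟩ := exists_between hac.1 c.isOpen hac.2
    exact ⟨U, ⟨hac.1, h1⟩, h2, h3⟩
  ll6 := fun a ha => by
    rw [Ne, eq_bot_iff_set, ← Ne, ← Set.nonempty_iff_ne_empty] at ha
    obtain ⟨x, hx⟩ := ha
    obtain ⟨U, h1, h2, h3⟩ := exists_mem_nhds a.isOpen hx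
    refine ⟨U, ?_, h2, h3⟩
    rw [Ne, eq_bot_iff_set, ← Ne, ← Set.nonempty_iff_ne_empty]
    exact ⟨x, h1⟩
  ll4' := fun a b c hab hac => ⟨hab.1, Set.subset_inter hab.2 hac.2⟩
  mvd := fun a b ha hba => ⟨ha.1, by
    have h := hba.2
    rw [set_compl, set_compl, closure_compl, interior_closure_set] at h
    exact Set.compl_subset_compl.1 h⟩


/-! ### Pulling regular open sets back along open maps. -/

/-- The preimage of a regular open set under a continuous open map. -/
def comap (f : X → Y) (hf : Continuous f) (U : RegOpens Y) : RegOpens X :=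
  ofOpen (f ⁻¹' U.set) (U.isOpen.preimage hf)

/-- Preimages under an open continuous map commute with closure and interior, so the regularization
in `comap` changes nothing. -/
theorem set_comap {f : X → Y} (hf : Continuous f) (ho : IsOpenMap f) (U : RegOpens Y) :
    (comap f hf U).set = f ⁻¹' U.set := by
  rw [comap, set_ofOpen, ← ho.preimage_closure_eq_closure_preimage hf,
    ← ho.preimage_interior_eq_interior_preimage hf, interior_closure_set]

theorem comap_compl {f : X → Y} (hf : Continuous f) (ho : IsOpenMap f) (U : RegOpens Y) :
    comap f hf Uᶜ = (comap f hf U)ᶜ := by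
  apply set_injective
  rw [set_comap hf ho, set_compl, set_compl, set_comap hf ho, Set.preimage_compl,
    ho.preimage_closure_eq_closure_preimage hf]

theorem comap_sSup {f : X → Y} (hf : Continuous f) (ho : IsOpenMap f) (S : Set (RegOpens Y)) :
    comap f hf (sSup S) = sSup (comap f hf '' S) := by
  apply set_injective
  rw [set_comap hf ho, sSup_eq, sSup_eq, set_ofOpen, set_ofOpen,
    ho.preimage_interior_eq_interior_preimage hf, ho.preimage_closure_eq_closure_preimage hf]
  simp [set_comap hf ho]

/-- The complete Boolean homomorphism induced by a continuous open map. -/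
def comapHom (f : X → Y) (hf : Continuous f) (ho : IsOpenMap f) :
    CompleteLatticeHom (RegOpens Y) (RegOpens X) where
  toFun := comap f hf
  map_sSup' := comap_sSup hf ho
  map_sInf' := fun S => by
    apply compl_injective
    rw [← comap_compl hf ho, compl_sInf', comap_sSup hf ho, compl_sInf']
    congr 1
    ext U
    simp only [Set.mem_image, Set.image_image, comap_compl hf ho]

theorem set_comapHom {f : X → Y} (hf : Continuous f) (ho : IsOpenMap f) (U : RegOpens Y) :
    (comapHom f hf ho U).set = f ⁻¹' U.set := set_comap hf ho U

theorem lowerAdjoint_comapHom {f : X → Y} (hf : Continuous f) (ho : IsOpenMap f)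
    (V : RegOpens X) :
    lowerAdjoint (comapHom f hf ho) V = ofOpen (f '' V.set) (ho _ V.isOpen) := by
  refine eq_of_forall_ge_iff fun U => ?_
  rw [lowerAdjoint_gc _ V U, ofOpen_le_iff, Set.image_subset_iff, ← set_comapHom hf ho,
    set_le_set]

end RegOpens

/-- The complete MVD-algebra of regular open subsets of a locally compact Hausdorff space. -/
@[reducible] def LCHaus.regOpens (X : LCHaus.{u}) : CMVD.{u} :=
  ⟨RegOpens X.carrier, RegOpens.LL, RegOpens.isMVD⟩

theorem IsOpenPerfect.isProperMap {X Y : Type u} [TopologicalSpace X] [TopologicalSpace Y]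
    {f : X → Y} (hf : IsOpenPerfect f) : IsProperMap f :=
  isProperMap_iff_isClosedMap_and_compact_fibers.2 ⟨hf.1, hf.3, hf.4⟩

/-- Openness makes preimage commute with closure, and properness keeps preimages of compact sets
compact: this gives (ES1) and (S3). For relatively compact `V`, the closure of `φ_Λ V` is the
compact set `f '' closure V`: this gives (S2) and (SO). -/
theorem IsOpenPerfect.isOpenPerfectMVD {X Y : LCHaus.{u}} {f : X.carrier → Y.carrier}
    (hf : IsOpenPerfect f) : IsOpenPerfectMVD (A := Y.regOpens) (B := X.regOpens)
      (RegOpens.comapHom f hf.continuous hf.isOpenMap) := by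
  have himage (V : RegOpens X.carrier) (hV : IsCompact (closure V.set)) :
      closure (lowerAdjoint (RegOpens.comapHom f hf.continuous hf.isOpenMap) V).set =
        f '' closure V.set := by
    rw [RegOpens.lowerAdjoint_comapHom, RegOpens.closure_ofOpen]
    exact (image_closure_of_isCompact hV hf.continuous.continuousOn).symm
  have hcomap (U : RegOpens Y.carrier) :
      closure (RegOpens.comapHom f hf.continuous hf.isOpenMap U).set = f ⁻¹' closure U.set := by
    rw [RegOpens.set_comapHom, hf.isOpenMap.preimage_closure_eq_closure_preimage hf.continuous]
  refine ⟨fun U V h => ?_, fun V hV => ?_, fun U hU => ?_, fun U V hV => ?_⟩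
  · refine ⟨?_, ?_⟩
    · rw [hcomap]
      exact hf.isProperMap.isCompact_preimage h.1
    · rw [hcomap, RegOpens.set_comapHom]
      exact Set.preimage_mono h.2
  · refine RegOpens.LL.top.2 ?_
    rw [himage _ hV.1]
    exact hV.1.image hf.continuous
  · refine RegOpens.LL.top.2 ?_
    rw [hcomap]
    exact hf.isProperMap.isCompact_preimage hU.1
  · have h2 := hV.2
    rw [RegOpens.set_comapHom] at h2
    refine ⟨?_, ?_⟩
    · rw [himage _ hV.1]
      exact hV.1.image hf.continuous
    · rw [himage _ hV.1]
      exact Set.image_subset_iff.2 h2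

/-! ## Every morphism between algebras of regular open sets comes from an open perfect map -/

section Fullness

variable {X Y : LCHaus.{u}}
  {φ : CompleteLatticeHom Y.regOpens.carrier X.regOpens.carrier}

open RegOpens

theorem finset_sup_ll {B : Type u} [BooleanAlgebra B] {ll : B → B → Prop} (h : IsMVD ll)
    {ι : Type*} (t : Finset ι) (f : ι → B) {b : B} (hf : ∀ i ∈ t, ll (f i) b) : ll (t.sup f) b :=
  Finset.sup_induction (p := fun x => ll x b) (h.bot_ll b) (fun _ h1 _ h2 => h.ll4 _ _ _ h1 h2) hf

theorem RegOpens.closure_finset_sup {Z : Type u} [TopologicalSpace Z] {ι : Type*} (t : Finset ι)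
    (f : ι → RegOpens Z) : closure (t.sup f).set = ⋃ i ∈ t, closure (f i).set := by
  classical
  induction t using Finset.induction_on with
  | empty => simp [set_bot]
  | insert a t ha ih => rw [Finset.sup_insert, closure_sup, ih, Finset.set_biUnion_insert]

/-- If every `y` had some `U y` with `x ∉ φ (U y)`, shrink to `W y ≪ U y`. For a relatively compact
`V` around `x`, (S2) lets finitely many `W y` cover `φ_Λ V`, so `x` lies in `φ` of their join. -/
theorem IsOpenPerfectMVD.exists_point
    (h : IsOpenPerfectMVD (A := Y.regOpens) (B := X.regOpens) φ) (x : X.carrier) :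
    ∃ y : Y.carrier, ∀ U : RegOpens Y.carrier, y ∈ U.set → x ∈ (φ U).set := by
  by_contra! hn
  choose U hyU hxU using hn
  choose W hyW hWc hWU using fun y => exists_mem_nhds (U y).isOpen (hyU y)
  obtain ⟨V, hxV, hVc, -⟩ := exists_mem_nhds isOpen_univ (Set.mem_univ x)
  have hK := LL.top.1 (h.s2 V (LL.top.2 hVc))
  obtain ⟨t, ht⟩ := hK.elim_finite_subcover (fun y => (W y).set) (fun y => (W y).isOpen)
    (fun y _ => Set.mem_iUnion.2 ⟨y, hyW y⟩)
  have h1 : lowerAdjoint φ V ≤ t.sup W := by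
    refine set_le_set.1 (subset_closure.trans (ht.trans (Set.iUnion₂_subset fun y hy => ?_)))
    exact set_le_set.2 (Finset.le_sup hy)
  have h2 := ((lowerAdjoint_gc φ).le_u_l V).trans (OrderHomClass.mono φ h1)
  -- Only after taking closures does the finite join become a union; (ES1) then absorbs the closure
  -- of `φ (W y)` into `φ (U y)`.
  have h3 : x ∈ closure (φ (t.sup W)).set := subset_closure (set_le_set.2 h2 hxV)
  have h4 : φ (t.sup W) = t.sup (φ ∘ W) := map_finset_sup φ t W
  rw [h4, closure_finset_sup] at h3
  obtain ⟨y, -, hy⟩ := Set.mem_iUnion₂.1 h3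
  exact hxU y ((h.es1 _ _ ⟨hWc y, hWU y⟩).2 hy)

theorem IsOpenPerfectMVD.exists_map
    (h : IsOpenPerfectMVD (A := Y.regOpens) (B := X.regOpens) φ) :
    ∃ f : X.carrier → Y.carrier, ∀ U : RegOpens Y.carrier, (φ U).set = f ⁻¹' U.set := by
  choose f hf using h.exists_point
  refine ⟨f, fun U => Set.Subset.antisymm (fun x hx => ?_) fun x hx => hf x U hx⟩
  obtain ⟨V, hxV, hVc, hVU⟩ := exists_mem_nhds (φ U).isOpen hx
  -- By (SO) it is enough that `f x` lies in the closure of `φ_Λ V`. Otherwise some `W` around `f x`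
  -- misses `φ_Λ V`, and `x` would lie in both of the disjoint sets `φ W` and `φ (φ_Λ V)`.
  have h1 := (h.so U V ⟨hVc, hVU⟩).2
  by_contra hxU
  obtain ⟨W, hxW, -, hW⟩ := exists_mem_nhds
    (isClosed_closure (s := (lowerAdjoint φ V).set)).isOpen_compl (fun h' => hxU (h1 h') : f x ∈ _)
  have h2 : Disjoint W (lowerAdjoint φ V) := disjoint_iff_set.2 <|
    Set.disjoint_left.2 fun z hz hz' => hW (subset_closure hz) (subset_closure hz')
  have h3 : Disjoint (φ W) (φ (lowerAdjoint φ V)) := h2.map φ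
  exact Set.disjoint_left.1 (disjoint_iff_set.1 h3) (hf x W hxW)
    (set_le_set.2 ((lowerAdjoint_gc φ).le_u_l V) hxV)

theorem IsOpenPerfectMVD.isOpenPerfect
    (h : IsOpenPerfectMVD (A := Y.regOpens) (B := X.regOpens) φ) {f : X.carrier → Y.carrier}
    (hf : ∀ U : RegOpens Y.carrier, (φ U).set = f ⁻¹' U.set) : IsOpenPerfect f := by
  have hcont : Continuous f := by
    refine continuous_def.2 fun s hs => isOpen_iff_mem_nhds.2 fun x hx => ?_
    obtain ⟨U, hxU, -, hU⟩ := exists_mem_nhds hs hx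
    refine Filter.mem_of_superset ((φ U).isOpen.mem_nhds (?_ : x ∈ (φ U).set)) ?_
    · rw [hf]
      exact hxU
    · rw [hf]
      exact Set.preimage_mono (subset_closure.trans hU)
  have hopen : IsOpenMap f := by
    refine fun s hs => isOpen_iff_mem_nhds.2 ?_
    rintro _ ⟨x, hx, rfl⟩
    obtain ⟨V, hxV, hVc, hVs⟩ := exists_mem_nhds hs hx
    -- `φ_Λ V` is the required neighbourhood of `f x`. It lies in the closed set `f '' closure V`,
    -- since a regular open `U` missing that set has `V ≤ φ Uᶜ`, that is, `φ_Λ V ≤ Uᶜ`.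
    have h1 : f x ∈ (lowerAdjoint φ V).set := by
      rw [← Set.mem_preimage, ← hf]
      exact set_le_set.2 ((lowerAdjoint_gc φ).le_u_l V) hxV
    refine Filter.mem_of_superset ((lowerAdjoint φ V).isOpen.mem_nhds h1) fun y hy => ?_
    refine Set.image_mono hVs ?_
    by_contra hn
    obtain ⟨U, hyU, -, hU⟩ := exists_mem_nhds (hVc.image hcont).isClosed.isOpen_compl hn
    have h2 : V ≤ φ Uᶜ := by
      rw [map_compl', le_compl_iff_disjoint_left, disjoint_iff_set, hf]
      exact Set.disjoint_left.2 fun z hz hz' =>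
        hU (subset_closure hz) ⟨z, subset_closure hz', rfl⟩
    have h3 : lowerAdjoint φ V ≤ Uᶜ := (lowerAdjoint_gc φ _ _).2 h2
    exact Set.disjoint_left.1 (disjoint_iff_set.1 (le_compl_iff_disjoint_left.1 h3)) hyU hy
  have hproper : IsProperMap f := by
    refine isProperMap_iff_isCompact_preimage.2 ⟨hcont, fun K hK => ?_⟩
    obtain ⟨U, hKU, hUc, -⟩ := exists_between hK isOpen_univ (Set.subset_univ K)
    refine (LL.top.1 (h.s3 U (LL.top.2 hUc))).of_isClosed_subset
      (hK.isClosed.preimage hcont) (subset_closure.trans' ?_)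
    rw [hf]
    exact Set.preimage_mono hKU
  exact ⟨hcont, hopen, hproper.isClosedMap,
    fun y => hproper.isCompact_preimage isCompact_singleton⟩

theorem IsOpenPerfectMVD.exists_eq_comapHom
    (h : IsOpenPerfectMVD (A := Y.regOpens) (B := X.regOpens) φ) :
    ∃ (f : X.carrier → Y.carrier) (hf : IsOpenPerfect f),
      comapHom f hf.continuous hf.isOpenMap = φ := by
  obtain ⟨f, hf⟩ := h.exists_map
  refine ⟨f, h.isOpenPerfect hf, DFunLike.ext _ _ fun U => set_injective ?_⟩
  rw [set_comapHom, hf]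

/-- An open perfect map is determined by its action on regular open sets. -/
theorem RegOpens.comapHom_injective {f g : X.carrier → Y.carrier} (hf : IsOpenPerfect f)
    (hg : IsOpenPerfect g)
    (h : comapHom f hf.continuous hf.isOpenMap = comapHom g hg.continuous hg.isOpenMap) :
    f = g := by
  funext x
  by_contra hne
  obtain ⟨U, hU, -, hU'⟩ := exists_mem_nhds (isClosed_singleton (x := g x)).isOpen_compl
    (by simpa using hne : f x ∈ _)
  have h1 : x ∈ (comapHom f hf.continuous hf.isOpenMap U).set := by
    rw [set_comapHom]
    exact hU
  rw [h, set_comapHom] at h1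
  exact hU' (subset_closure h1) rfl

theorem RegOpens.comapHom_injective_iff {f : X.carrier → Y.carrier} (hf : IsOpenPerfect f) :
    Function.Injective (comapHom f hf.continuous hf.isOpenMap) ↔ Function.Surjective f := by
  constructor
  · intro h
    by_contra hn
    obtain ⟨y, hy⟩ := not_forall.1 hn
    -- As the range is closed, a missed point has a regular open neighbourhood with empty preimage.
    obtain ⟨U, hyU, -, hU⟩ := exists_mem_nhds hf.isClosedMap.isClosed_range.isOpen_compl
      (hy : y ∈ (Set.range f)ᶜ)
    have h1 : comapHom f hf.continuous hf.isOpenMap U = ⊥ := by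
      rw [eq_bot_iff_set, set_comapHom, Set.eq_empty_iff_forall_notMem]
      exact fun x hx => hU (subset_closure hx) ⟨x, rfl⟩
    have h2 : U = ⊥ := h (h1.trans (map_bot _).symm)
    rw [eq_bot_iff_set] at h2
    exact Set.notMem_empty y (h2 ▸ hyU)
  · intro h U V hUV
    have := congrArg RegOpens.set hUV
    rw [set_comapHom, set_comapHom] at this
    exact set_injective (Set.preimage_injective.2 h this)

theorem RegOpens.comapHom_surjective_iff {f : X.carrier → Y.carrier} (hf : IsOpenPerfect f) :
    Function.Surjective (comapHom f hf.continuous hf.isOpenMap) ↔ Function.Injective f := by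
  constructor
  · intro h x x' hxx'
    by_contra hne
    obtain ⟨V, hV, -, hV'⟩ := exists_mem_nhds (isClosed_singleton (x := x')).isOpen_compl
      (by simpa using hne : x ∈ _)
    obtain ⟨U, rfl⟩ := h V
    rw [set_comapHom] at hV hV'
    refine hV' (subset_closure ?_) rfl
    rw [Set.mem_preimage, hxx'] at hV
    exact hV
  · intro h V
    refine ⟨ofOpen (f '' V.set) (hf.isOpenMap _ V.isOpen), set_injective ?_⟩
    rw [set_comapHom, set_ofOpen, hf.isOpenMap.preimage_interior_eq_interior_preimage hf.continuous,
      hf.isOpenMap.preimage_closure_eq_closure_preimage hf.continuous, Set.preimage_image_eq _ h,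
      interior_closure_set]

end Fullness

/-! ## The space of a complete MVD-algebra -/

namespace CMVD

/-- The points of the space of an MVD-algebra: proper round filters that are prime with respect
to `≪`. -/
structure Point (A : CMVD.{u}) : Type u where
  carrier : Set A.carrier
  nonempty : carrier.Nonempty
  upper : ∀ a b, a ≤ b → a ∈ carrier → b ∈ carrier
  inf : ∀ a b, a ∈ carrier → b ∈ carrier → a ⊓ b ∈ carrier
  bot_notMem : ⊥ ∉ carrier
  round : ∀ a ∈ carrier, ∃ b ∈ carrier, A.ll b a
  prime : ∀ a b, A.ll a b → aᶜ ∈ carrier ∨ b ∈ carrier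

variable {A : CMVD.{u}}

/-- The points containing `a`. -/
def Point.basic (a : A.carrier) : Set A.Point := {p | a ∈ p.carrier}

namespace Point

theorem ext {p q : A.Point} (h : p.carrier = q.carrier) : p = q := by
  cases p
  cases q
  congr

/-- The round filter below a filter containing a bounded element, provided that the filter is
suitably prime. -/
def ofFilter (F : Set A.carrier) (upper : ∀ a b, a ≤ b → a ∈ F → b ∈ F)
    (inf : ∀ a b, a ∈ F → b ∈ F → a ⊓ b ∈ F) (bot_notMem : ⊥ ∉ F)
    (bounded : ∃ e ∈ F, A.ll e ⊤) (prime : ∀ a b, A.ll a b → aᶜ ∈ F ∨ b ∈ F) : A.Point where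
  carrier := {a | ∃ b ∈ F, A.ll b a}
  nonempty := ⟨⊤, bounded⟩
  upper := fun a b hab ⟨c, hc, hca⟩ => ⟨c, hc, A.isMVD.mono_right hca hab⟩
  inf := fun a b ⟨c, hc, hca⟩ ⟨d, hd, hdb⟩ => ⟨c ⊓ d, inf _ _ hc hd, A.isMVD.inf_ll_inf hca hdb⟩
  bot_notMem := fun ⟨c, hc, hcb⟩ => bot_notMem (upper _ _ (A.isMVD.ll1 _ _ hcb) hc)
  round := fun a ⟨c, hc, hca⟩ => by
    obtain ⟨b, hcb, hba⟩ := A.isMVD.ll5 _ _ hca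
    exact ⟨b, ⟨c, hc, hcb⟩, hba⟩
  prime := fun a b hab => by
    obtain ⟨e, he, he1⟩ := bounded
    -- Interpolating `a ≪ c ≪ d ≪ b` and testing primeness on `c ≪ d` leaves room on both sides to
    -- pass to the round part; `e` supplies boundedness for `cᶜ`.
    obtain ⟨c, hac, hcb⟩ := A.isMVD.ll5 _ _ hab
    obtain ⟨d, hcd, hdb⟩ := A.isMVD.ll5 _ _ hcb
    rcases prime c d hcd with hc | hd
    · exact Or.inl ⟨e ⊓ cᶜ, inf _ _ he hc, A.isMVD.inf_compl_ll_compl hac he1⟩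
    · exact Or.inr ⟨d, hd, hdb⟩

theorem basic_inf (a b : A.carrier) : basic (a ⊓ b) = basic a ∩ basic b := by
  ext p
  exact ⟨fun h => ⟨p.upper _ _ inf_le_left h, p.upper _ _ inf_le_right h⟩,
    fun h => p.inf _ _ h.1 h.2⟩

theorem basic_mono {a b : A.carrier} (h : a ≤ b) : basic a ⊆ basic b := fun p => p.upper _ _ h

theorem basic_bot : basic (⊥ : A.carrier) = ∅ :=
  Set.eq_empty_iff_forall_notMem.2 fun p => p.bot_notMem

/-- For nonzero `b ≪ a`, the complement of a prime ideal avoiding `b` is an ultrafilter containing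
`b`; its round part is a point containing `a`. -/
theorem basic_nonempty {a : A.carrier} (ha : a ≠ ⊥) : (basic a).Nonempty := by
  obtain ⟨b, hb, hba⟩ := A.isMVD.ll6 a ha
  have hdisj : Disjoint (Order.PFilter.principal b : Set A.carrier)
      (Order.Ideal.principal ⊥ : Order.Ideal A.carrier) := by
    refine Set.disjoint_left.2 fun x hx hx' => hb ?_
    have h1 : b ≤ x := hx
    have h2 : x ≤ ⊥ := hx'
    exact le_bot_iff.1 (h1.trans h2)
  obtain ⟨J, hJ, -, hbJ⟩ := DistribLattice.prime_ideal_of_disjoint_filter_ideal hdisj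
  have hb' : b ∉ J := Set.disjoint_left.1 hbJ (le_rfl : b ≤ b)
  refine ⟨ofFilter {x | x ∉ J} (fun x y hxy hx hy => hx (J.lower hxy hy))
    (fun x y hx hy hxy => (hJ.mem_or_mem hxy).elim hx hy) (fun h => h J.bot_mem)
    ⟨b, hb', A.isMVD.ll_top hba⟩ (fun x y hxy => ?_), b, hb', hba⟩
  by_contra! hn
  simp only [Set.mem_ofPred_eq, not_not] at hn
  have hx : x ∈ J := J.lower (A.isMVD.ll1 _ _ hxy) hn.2
  refine hJ.toIsProper.top_notMem ?_
  rw [← sup_compl_eq_top (x := x)]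
  exact Order.Ideal.sup_mem hx hn.1

theorem basic_inter_eq_empty {a b : A.carrier} : basic a ∩ basic b = ∅ ↔ a ≤ bᶜ := by
  rw [← basic_inf, le_compl_iff_disjoint_right, disjoint_iff]
  refine ⟨fun h => ?_, fun h => by rw [h, basic_bot]⟩
  by_contra hn
  exact (basic_nonempty hn).ne_empty h

instance : TopologicalSpace A.Point := generateFrom (Set.range basic)

theorem isTopologicalBasis_basic :
    IsTopologicalBasis (Set.range (basic : A.carrier → Set A.Point)) where
  exists_subset_inter := by
    rintro _ ⟨a, rfl⟩ _ ⟨b, rfl⟩ p hp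
    exact ⟨_, ⟨a ⊓ b, rfl⟩, by rwa [basic_inf], (basic_inf a b).subset⟩
  sUnion_eq := by
    refine Set.eq_univ_of_forall fun p => ?_
    obtain ⟨a, ha⟩ := p.nonempty
    exact ⟨basic a, ⟨a, rfl⟩, ha⟩
  eq_generateFrom := rfl

theorem isOpen_basic (a : A.carrier) : IsOpen (basic a) :=
  isTopologicalBasis_basic.isOpen ⟨a, rfl⟩

theorem exists_basic_subset {s : Set A.Point} (hs : IsOpen s) {p : A.Point} (hp : p ∈ s) :
    ∃ a ∈ p.carrier, basic a ⊆ s := by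
  obtain ⟨_, ⟨a, rfl⟩, ha, has⟩ := isTopologicalBasis_basic.exists_subset_of_mem_open hp hs
  exact ⟨a, ha, has⟩

theorem closure_basic (a : A.carrier) : closure (basic a) = (basic aᶜ)ᶜ := by
  refine Set.Subset.antisymm (closure_minimal ?_ (isOpen_basic _).isClosed_compl) fun p hp => ?_
  · exact Set.disjoint_left.1 (Set.disjoint_iff_inter_eq_empty.2
      (basic_inter_eq_empty.2 (compl_compl a).ge))
  · refine mem_closure_iff.2 fun s hs hps => ?_
    obtain ⟨b, hb, hbs⟩ := exists_basic_subset hs hps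
    by_contra hn
    have h1 : basic b ∩ basic a = ∅ := Set.subset_eq_empty
      (Set.inter_subset_inter_left _ hbs) (Set.not_nonempty_iff_eq_empty.1 hn)
    exact hp (basic_mono (basic_inter_eq_empty.1 h1) hb)

/-- This is primeness of points, read through `closure_basic`. -/
theorem closure_basic_subset {a b : A.carrier} (h : A.ll a b) : closure (basic a) ⊆ basic b := by
  rw [closure_basic]
  exact fun p hp => (p.prime a b h).resolve_left hp

/-- The limit of an ultrafilter `𝓤` is the round part of `{c | basic c ∈ 𝓤}`. An `e` with `a ≪ e ≪
⊤` provides the bounded element that `ofFilter` requires. -/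
theorem isCompact_closure_basic {a : A.carrier} (ha : A.ll a ⊤) :
    IsCompact (closure (basic a)) := by
  refine isCompact_iff_ultrafilter_le_nhds.2 fun 𝓤 h𝓤 => ?_
  rw [Filter.le_principal_iff] at h𝓤
  obtain ⟨e, hae, he⟩ := A.isMVD.ll5 _ _ ha
  have he' : basic e ∈ 𝓤 := Filter.mem_of_superset h𝓤 (closure_basic_subset hae)
  let p : A.Point := ofFilter {c | basic c ∈ 𝓤}
    (fun c d hcd hc => Filter.mem_of_superset hc (basic_mono hcd))
    (fun c d hc hd => by
      simp only [Set.mem_ofPred_eq, basic_inf]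
      exact Filter.inter_mem hc hd)
    (fun h => 𝓤.empty_notMem (basic_bot (A := A) ▸ h))
    ⟨e, he', he⟩
    (fun c d hcd => by
      by_contra! hn
      have h1 : (basic cᶜ)ᶜ ∈ 𝓤 := Ultrafilter.compl_mem_iff_notMem.2 hn.1
      rw [← closure_basic] at h1
      exact hn.2 (Filter.mem_of_superset h1 (closure_basic_subset hcd)))
  have hp : (𝓤 : Filter A.Point) ≤ 𝓝 p := by
    intro s hs
    obtain ⟨t, hts, ht, hpt⟩ := mem_nhds_iff.1 hs
    obtain ⟨c, ⟨b, hb, hbc⟩, hct⟩ := exists_basic_subset ht hpt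
    exact Filter.mem_of_superset hb ((basic_mono (A.isMVD.ll1 _ _ hbc)).trans (hct.trans hts))
  exact ⟨p, isClosed_closure.mem_of_tendsto (f := id) (b := (𝓤 : Filter A.Point)) hp h𝓤, hp⟩

instance : T2Space A.Point := by
  have key : ∀ p q : A.Point, ¬ p.carrier ⊆ q.carrier →
      ∃ u v : Set A.Point, IsOpen u ∧ IsOpen v ∧ p ∈ u ∧ q ∈ v ∧ Disjoint u v := by
    intro p q h
    obtain ⟨a, hap, haq⟩ := Set.not_subset.1 h
    obtain ⟨b, hb, hba⟩ := p.round a hap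
    exact ⟨basic b, basic bᶜ, isOpen_basic _, isOpen_basic _, hb,
      (q.prime b a hba).resolve_right haq, Set.disjoint_iff_inter_eq_empty.2
        (basic_inter_eq_empty.2 (compl_compl b).ge)⟩
  refine ⟨fun p q hpq => ?_⟩
  by_cases h : p.carrier ⊆ q.carrier
  · have h' : ¬ q.carrier ⊆ p.carrier := fun h' => hpq (ext (h.antisymm h'))
    obtain ⟨u, v, hu, hv, hqu, hpv, huv⟩ := key q p h'
    exact ⟨v, u, hv, hu, hpv, hqu, huv.symm⟩
  · exact key p q h

instance : WeaklyLocallyCompactSpace A.Point where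
  exists_compact_mem_nhds := fun p => by
    obtain ⟨a, ha⟩ := p.nonempty
    obtain ⟨b, hb, hba⟩ := p.round a ha
    exact ⟨closure (basic b), isCompact_closure_basic (A.isMVD.ll_top hba),
      Filter.mem_of_superset ((isOpen_basic b).mem_nhds hb) subset_closure⟩

open RegOpens

/-- The regular open set of points containing `a`. -/
def toRegOpens (a : A.carrier) : RegOpens A.Point := ofOpen (basic a) (isOpen_basic a)

theorem set_toRegOpens (a : A.carrier) : (toRegOpens a).set = basic a := by
  rw [toRegOpens, set_ofOpen, closure_basic, interior_compl, closure_basic, compl_compl,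
    compl_compl]

theorem toRegOpens_le_iff {a b : A.carrier} : toRegOpens a ≤ toRegOpens b ↔ a ≤ b := by
  rw [← set_le_set, set_toRegOpens, set_toRegOpens]
  refine ⟨fun h => ?_, basic_mono⟩
  rw [← compl_compl b, ← basic_inter_eq_empty, ← Set.disjoint_iff_inter_eq_empty]
  exact (Set.disjoint_iff_inter_eq_empty.2 (basic_inter_eq_empty.2 (compl_compl b).ge)).mono_left h

/-- Completeness enters here: `U` comes from the join of all `c` with `basic c ⊆ U`. No point of
that join escapes `closure U`, for a basic `b` missing `U` bounds every such `c`, hence the join, by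
`bᶜ`. -/
theorem toRegOpens_surjective : Function.Surjective (toRegOpens (A := A)) := by
  intro U
  refine ⟨sSup {c | basic c ⊆ U.set}, le_antisymm ?_ ?_⟩
  · rw [toRegOpens, ofOpen_le_iff]
    refine (interior_closure_set U).subset.trans' <|
      interior_maximal (fun p hp => mem_closure_iff.2 fun s hs hps => ?_) (isOpen_basic _)
    obtain ⟨b, hb, hbs⟩ := exists_basic_subset hs hps
    by_contra hn
    have h1 : sSup {c | basic c ⊆ U.set} ≤ bᶜ := sSup_le fun c hc =>
      basic_inter_eq_empty.1 (Set.eq_empty_iff_forall_notMem.2 fun q hq =>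
        hn ⟨q, hbs hq.2, hc hq.1⟩)
    exact (basic_inter_eq_empty.2 h1).subset ⟨hp, hb⟩
  · rw [← set_le_set, set_toRegOpens]
    intro p hp
    obtain ⟨c, hc, hcU⟩ := exists_basic_subset U.isOpen hp
    exact basic_mono (le_sSup hcU) hc

/-- Roundness covers `closure (basic a)` by sets `basic c` with `c ≪ b`; compactness leaves finitely
many, and their join is still `≪ b`. -/
theorem ll_toRegOpens_iff {a b : A.carrier} :
    LL (toRegOpens a) (toRegOpens b) ↔ A.ll a b := by
  rw [LL, set_toRegOpens, set_toRegOpens]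
  refine ⟨fun ⟨hc, hab⟩ => ?_, fun h =>
    ⟨isCompact_closure_basic (A.isMVD.ll_top h), closure_basic_subset h⟩⟩
  obtain ⟨t, ht⟩ := hc.elim_finite_subcover (fun c : {c // A.ll c b} => basic c.1)
    (fun c => isOpen_basic c.1) fun p hp => by
      obtain ⟨c, hc, hcb⟩ := p.round b (hab hp)
      exact Set.mem_iUnion.2 ⟨⟨c, hcb⟩, hc⟩
  refine A.isMVD.mono_left ?_ (finset_sup_ll A.isMVD t (fun c => c.1) fun c _ => c.2)
  rw [← toRegOpens_le_iff, ← set_le_set, set_toRegOpens, set_toRegOpens]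
  exact subset_closure.trans (ht.trans (Set.iUnion₂_subset fun c hc =>
    basic_mono (Finset.le_sup (f := fun c : {c // A.ll c b} => c.1) hc)))

/-- A complete MVD-algebra is isomorphic to the algebra of regular open sets of its space. -/
noncomputable def orderIso (A : CMVD.{u}) : A.carrier ≃o RegOpens A.Point where
  toEquiv := Equiv.ofBijective toRegOpens
    ⟨fun _ _ h => le_antisymm (toRegOpens_le_iff.1 h.le) (toRegOpens_le_iff.1 h.ge),
      toRegOpens_surjective⟩
  map_rel_iff' := toRegOpens_le_iff

end Point

/-- The space of a complete MVD-algebra. -/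
def toLCHaus (A : CMVD.{u}) : LCHaus.{u} := ⟨A.Point⟩

end CMVD

/-! ## The dual equivalences -/

open RegOpens

/-- An order isomorphism, as a complete Boolean homomorphism. -/
def orderIsoHom {A B : Type u} [CompleteBooleanAlgebra A] [CompleteBooleanAlgebra B]
    (e : A ≃o B) : CompleteLatticeHom A B where
  toFun := e
  map_sSup' := fun s => by rw [e.map_sSup, sSup_image]
  map_sInf' := fun s => by rw [e.map_sInf, sInf_image]

theorem lowerAdjoint_orderIsoHom {A B : Type u} [CompleteBooleanAlgebra A]
    [CompleteBooleanAlgebra B] (e : A ≃o B) (b : B) :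
    lowerAdjoint (orderIsoHom e) b = e.symm b :=
  (lowerAdjoint_gc (orderIsoHom e)).l_unique e.symm.to_galoisConnection (fun _ => rfl)

theorem isOpenPerfectMVD_orderIsoHom {A B : CMVD.{u}} (e : A.carrier ≃o B.carrier)
    (he : ∀ a b, B.ll (e a) (e b) ↔ A.ll a b) :
    IsOpenPerfectMVD (A := A) (B := B) (orderIsoHom e) where
  es1 := fun a b h => (he a b).2 h
  s2 := fun b hb => by
    rw [lowerAdjoint_orderIsoHom, ← he, e.apply_symm_apply, e.map_top]
    exact hb
  s3 := fun a ha => by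
    have := (he _ _).2 ha
    rwa [e.map_top] at this
  so := fun a b h => by
    rw [lowerAdjoint_orderIsoHom, ← he, e.apply_symm_apply]
    exact h

theorem CMVD.Point.ll_orderIso_symm_iff (A : CMVD.{u}) (U V : RegOpens A.Point) :
    A.ll ((orderIso A).symm U) ((orderIso A).symm V) ↔ LL U V := by
  rw [← ll_toRegOpens_iff]
  exact iff_of_eq (congrArg₂ LL ((orderIso A).apply_symm_apply U)
    ((orderIso A).apply_symm_apply V))

theorem RegOpens.comapHom_id (X : Type u) [TopologicalSpace X] :
    comapHom (fun x : X => x) continuous_id IsOpenMap.id = CompleteLatticeHom.id _ :=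
  DFunLike.ext _ _ fun U => set_injective (set_comapHom continuous_id IsOpenMap.id U)

theorem RegOpens.comapHom_comp {X Y Z : Type u} [TopologicalSpace X] [TopologicalSpace Y]
    [TopologicalSpace Z] {g : Y → Z} {f : X → Y} (hg : Continuous g) (hog : IsOpenMap g)
    (hf : Continuous f) (hof : IsOpenMap f) :
    comapHom (fun x => g (f x)) (hg.comp hf) (hog.comp hof) =
      (comapHom f hf hof).comp (comapHom g hg hog) := by
  refine DFunLike.ext _ _ fun U => set_injective ?_
  rw [CompleteLatticeHom.comp_apply, set_comapHom, set_comapHom, set_comapHom]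
  rfl

/-- The contravariant functor of regular open sets on surjective open perfect maps. -/
def SOPLC.regOpens : SOPLC.{u}ᵒᵖ ⥤ IIPA.{u} where
  obj X := ⟨X.unop.toLCHaus.regOpens⟩
  map f := ⟨comapHom f.unop.1 f.unop.2.1.continuous f.unop.2.1.isOpenMap,
    f.unop.2.1.isOpenPerfectMVD, (comapHom_injective_iff f.unop.2.1).2 f.unop.2.2⟩
  map_id X := Subtype.ext (comapHom_id X.unop.toLCHaus.carrier)
  map_comp f g := Subtype.ext (comapHom_comp f.unop.2.1.continuous f.unop.2.1.isOpenMap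
    g.unop.2.1.continuous g.unop.2.1.isOpenMap)

/-- The contravariant functor of regular open sets on injective open perfect maps. -/
def IOPLC.regOpens : IOPLC.{u}ᵒᵖ ⥤ SIPA.{u} where
  obj X := ⟨X.unop.toLCHaus.regOpens⟩
  map f := ⟨comapHom f.unop.1 f.unop.2.1.continuous f.unop.2.1.isOpenMap,
    f.unop.2.1.isOpenPerfectMVD, (comapHom_surjective_iff f.unop.2.1).2 f.unop.2.2⟩
  map_id X := Subtype.ext (comapHom_id X.unop.toLCHaus.carrier)
  map_comp f g := Subtype.ext (comapHom_comp f.unop.2.1.continuous f.unop.2.1.isOpenMap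
    g.unop.2.1.continuous g.unop.2.1.isOpenMap)

instance : SOPLC.regOpens.{u}.IsEquivalence where
  faithful := ⟨fun {_ _ f g} h => Quiver.Hom.unop_inj (Subtype.ext
    (comapHom_injective f.unop.2.1 g.unop.2.1 (congrArg Subtype.val h)))⟩
  full := ⟨fun φ => by
    obtain ⟨f, hf, hφ⟩ := φ.2.1.exists_eq_comapHom
    have hs : Function.Surjective f := (comapHom_injective_iff hf).1 (hφ ▸ φ.2.2)
    exact ⟨Quiver.Hom.op ⟨f, hf, hs⟩, Subtype.ext hφ⟩⟩
  essSurj := ⟨fun A => by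
    -- An order isomorphism that preserves and reflects `≪` satisfies all four conditions in both
    -- directions, its lower adjoint being its inverse.
    let e := CMVD.Point.orderIso A.toCMVD
    exact ⟨Opposite.op ⟨A.toCMVD.toLCHaus⟩, ⟨{
      hom := ⟨orderIsoHom e.symm, isOpenPerfectMVD_orderIsoHom (A := A.toCMVD.toLCHaus.regOpens)
        e.symm (CMVD.Point.ll_orderIso_symm_iff A.toCMVD), e.symm.injective⟩
      inv := ⟨orderIsoHom e, isOpenPerfectMVD_orderIsoHom (B := A.toCMVD.toLCHaus.regOpens)
        e (fun _ _ => CMVD.Point.ll_toRegOpens_iff), e.injective⟩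
      hom_inv_id := Subtype.ext (DFunLike.ext _ _ e.apply_symm_apply)
      inv_hom_id := Subtype.ext (DFunLike.ext _ _ e.symm_apply_apply) }⟩⟩⟩

instance : IOPLC.regOpens.{u}.IsEquivalence where
  faithful := ⟨fun {_ _ f g} h => Quiver.Hom.unop_inj (Subtype.ext
    (comapHom_injective f.unop.2.1 g.unop.2.1 (congrArg Subtype.val h)))⟩
  full := ⟨fun φ => by
    obtain ⟨f, hf, hφ⟩ := φ.2.1.exists_eq_comapHom
    have hs : Function.Injective f := (comapHom_surjective_iff hf).1 (hφ ▸ φ.2.2)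
    exact ⟨Quiver.Hom.op ⟨f, hf, hs⟩, Subtype.ext hφ⟩⟩
  essSurj := ⟨fun A => by
    let e := CMVD.Point.orderIso A.toCMVD
    exact ⟨Opposite.op ⟨A.toCMVD.toLCHaus⟩, ⟨{
      hom := ⟨orderIsoHom e.symm, isOpenPerfectMVD_orderIsoHom (A := A.toCMVD.toLCHaus.regOpens)
        e.symm (CMVD.Point.ll_orderIso_symm_iff A.toCMVD), e.symm.surjective⟩
      inv := ⟨orderIsoHom e, isOpenPerfectMVD_orderIsoHom (B := A.toCMVD.toLCHaus.regOpens)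
        e (fun _ _ => CMVD.Point.ll_toRegOpens_iff), e.surjective⟩
      hom_inv_id := Subtype.ext (DFunLike.ext _ _ e.apply_symm_apply)
      inv_hom_id := Subtype.ext (DFunLike.ext _ _ e.symm_apply_apply) }⟩⟩⟩

theorem areDuallyEquivalent_SOPLC_IIPA : AreDuallyEquivalent SOPLC.{u} IIPA.{u} :=
  ⟨SOPLC.regOpens.asEquivalence⟩

theorem areDuallyEquivalent_IOPLC_SIPA : AreDuallyEquivalent IOPLC.{u} SIPA.{u} :=
  ⟨IOPLC.regOpens.asEquivalence⟩

end MVDDuality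

theorem mainTheorem7 :
    (MVDDuality.AreIsomorphic MVDDuality.IOPAL.{u} MVDDuality.IIPA.{u} ∧
      MVDDuality.AreDuallyEquivalent MVDDuality.SOPLC.{u} MVDDuality.IIPA.{u}) ∧
    (MVDDuality.AreIsomorphic MVDDuality.SOPAL.{u} MVDDuality.SIPA.{u} ∧
      MVDDuality.AreDuallyEquivalent MVDDuality.IOPLC.{u} MVDDuality.SIPA.{u}) :=
  ⟨⟨MVDDuality.areIsomorphic_IOPAL_IIPA, MVDDuality.areDuallyEquivalent_SOPLC_IIPA⟩,
    MVDDuality.areIsomorphic_SOPAL_SIPA, MVDDuality.areDuallyEquivalent_IOPLC_SIPA⟩
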